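/- Write $\log x=\max\{\ln x,2\}$, where $\ln$ is the natural logarithm, and define recursively $\log_1 x=\log x$ and $\log_k x=\log(\log_{k-1}x)$ for $k\ge 2$. For a positive integer $t$ and a prime power $q$, let $N_t(q)$ be the number of irreducible polynomials over the finite field $\mathbb{F}_q$ of the form $X^t-a$ with $a\in\mathbb{F}_q^*$. **Theorem.** For all real $A>0$ and $\varepsilon>0$ there are constants $q_0$ and $T_0$, depending only on $A$ and $\varepsilon$, such that for every prime power $q\ge q_0$ and every real $T\ge T_0$ with $$T\ge \bigl(\log (q-1)\bigr)^{(1+\varepsilon)A\log_3 q/\log_4 q}$$ we have $$\sum_{1\le t\le T}N_t(q)\le \frac{(q-1)\,T}{(\log T)^A}.$$ -/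

import Mathlib

/-- The truncated logarithm `log x = max {ln x, 2}`, where `ln` is the natural logarithm. -/
noncomputable def truncLog (x : ℝ) : ℝ := max (Real.log x) 2

/-- The iterated truncated logarithm: `log_1 x = log x`, `log_{k+1} x = log (log_k x)`
(and `log_0 x = x`). -/
noncomputable def iterTruncLog : ℕ → ℝ → ℝ
  | 0, x => x
  | k + 1, x => truncLog (iterTruncLog k x)

/-- The set of irreducible binomials of the form `X ^ t - a` over `F`.
A binomial has two nonzero terms, so `a ≠ 0`. -/
def irreducibleBinomials (F : Type*) [Field F] (t : ℕ) : Set (Polynomial F) :=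
  {f | Irreducible f ∧ ∃ a : F, a ≠ 0 ∧ f = Polynomial.X ^ t - Polynomial.C a}

/-- `N_t(q)`, the number of irreducible binomials `X ^ t - a` over the field `F` of `q` elements. -/
noncomputable def numIrreducibleBinomials (F : Type*) [Field F] (t : ℕ) : ℕ :=
  (irreducibleBinomials F t).ncard

/-!
If `X ^ t - a` is irreducible over the field of `q` elements, then every prime factor of `t` divides
`q - 1`. Hence the sum is at most `q - 1` times the number of `t ≤ T` composed of primes in a set
`s` with `∑ p ∈ s, log p ≤ y := log (q - 1)`.

Rankin's trick bounds such `t` by `T ^ (1 - δ)` times the Euler product over `s` at `1 - δ`. Writing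
`log = ζ * Λ` on the integers composed of these primes removes a factor `log T ≥ log y`, and
comparing the Euler product with `ζ (1 + 1 / log y)` shows that it is at most
`log y * exp (O (y ^ δ * (δ * log y + 1)))`, so the two logarithms cancel. With `L = log log y` and
`y ^ δ = L ^ c`, the remaining exponential is `exp (o (L))` as long as `c < 1`, while
`T ^ (-δ) = exp (-c * log L * log T / log y)` saves `exp (-c * (1 + ε) * A * L)` at the least
admissible `T`. This beats `(log T) ^ A = exp (A * L + o (L))` once `c * (1 + ε) > 1`.
-/

open Finset Filter Real
open scoped ArithmeticFunction.vonMangoldt ArithmeticFunction.zeta Chebyshev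

section PrimeSums

theorem sum_log_primeFactors_le_log (n : ℕ) : ∑ p ∈ n.primeFactors, log p ≤ log n := by
  calc ∑ p ∈ n.primeFactors, log p = ∑ p ∈ n.primeFactors, Λ p :=
        sum_congr rfl fun p hp => (ArithmeticFunction.vonMangoldt_apply_prime
          (Nat.prime_of_mem_primeFactors hp)).symm
    _ ≤ ∑ d ∈ n.divisors, Λ d :=
        sum_le_sum_of_subset_of_nonneg
          ((Nat.primeFactors_eq_to_filter_divisors_prime n).trans_subset (filter_subset _ _))
          fun _ _ _ => ArithmeticFunction.vonMangoldt_nonneg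
    _ = log n := ArithmeticFunction.vonMangoldt_sum

theorem theta_le_two_mul {x : ℝ} (hx : 0 ≤ x) : θ x ≤ 2 * x := by
  have hlog4 : log 4 ≤ 2 := by
    rw [log_le_iff_le_exp (by norm_num)]
    linarith [quadratic_le_exp_of_nonneg (zero_le_two (α := ℝ))]
  exact (Chebyshev.theta_le_log4_mul_x hx).trans (by gcongr)

theorem sum_prime_log_mul_div_le (N : ℕ) :
    ∑ p ∈ Ioc 0 N with p.Prime, log p * (N / p : ℕ) ≤ N * log N := by
  calc ∑ p ∈ Ioc 0 N with p.Prime, log p * (N / p : ℕ)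
      = ∑ p ∈ Ioc 0 N with p.Prime, Λ p * (N / p : ℕ) :=
        sum_congr rfl fun p hp => by
          rw [ArithmeticFunction.vonMangoldt_apply_prime (mem_filter.mp hp).2]
    _ ≤ ∑ n ∈ Ioc 0 N, Λ n * (N / n : ℕ) :=
        sum_le_sum_of_subset_of_nonneg (filter_subset _ _) fun _ _ _ =>
          mul_nonneg ArithmeticFunction.vonMangoldt_nonneg (Nat.cast_nonneg _)
    _ = ∑ n ∈ Ioc 0 N, log n := by
        rw [← ArithmeticFunction.sum_Ioc_mul_zeta_eq_sum, ArithmeticFunction.vonMangoldt_mul_zeta]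
        rfl
    _ ≤ ∑ _n ∈ Ioc 0 N, log N := by
        refine sum_le_sum fun n hn => ?_
        obtain ⟨hn0, hnN⟩ := mem_Ioc.mp hn
        gcongr
    _ = N * log N := by simp

theorem sum_prime_log_div_le (N : ℕ) :
    ∑ p ∈ Ioc 0 N with p.Prime, log p / p ≤ log N + 2 := by
  rcases N.eq_zero_or_pos with rfl | hN
  · simp
  have hN0 : (0 : ℝ) < N := by exact_mod_cast hN
  have hθ : ∑ p ∈ Ioc 0 N with p.Prime, log p ≤ 2 * N := by
    simpa only [Chebyshev.theta, Nat.floor_natCast] using theta_le_two_mul hN0.le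
  refine le_of_mul_le_mul_left ?_ hN0
  calc N * ∑ p ∈ Ioc 0 N with p.Prime, log p / p
      ≤ ∑ p ∈ Ioc 0 N with p.Prime, (log p * (N / p : ℕ) + log p) := by
        rw [mul_sum]
        refine sum_le_sum fun p _ => ?_
        have hdiv : (N : ℝ) / p ≤ (N / p : ℕ) + 1 := by
          rw [← Nat.floor_div_eq_div (K := ℝ)]
          exact (Nat.lt_floor_add_one _).le
        calc (N : ℝ) * (log p / p) = log p * (N / p) := by ring
          _ ≤ log p * ((N / p : ℕ) + 1) := by gcongr
          _ = _ := by ring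
    _ ≤ N * log N + 2 * N := by
        rw [sum_add_distrib]
        exact add_le_add (sum_prime_log_mul_div_le N) hθ
    _ = N * (log N + 2) := by ring

theorem sum_filter_log_div_le {s : Finset ℕ} (hs : ∀ p ∈ s, p.Prime) {y : ℝ} (hy : 1 ≤ y) :
    ∑ p ∈ s with ((p : ℕ) : ℝ) ≤ y, log p / p ≤ log y + 2 := by
  have hy0 : 0 ≤ y := zero_le_one.trans hy
  calc ∑ p ∈ s with ((p : ℕ) : ℝ) ≤ y, log p / p
      ≤ ∑ p ∈ Ioc 0 ⌊y⌋₊ with p.Prime, log p / p := by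
        refine sum_le_sum_of_subset_of_nonneg (fun p hp => ?_) fun p _ _ =>
          div_nonneg (log_natCast_nonneg p) p.cast_nonneg
        obtain ⟨hps, hpy⟩ := mem_filter.mp hp
        exact mem_filter.mpr ⟨mem_Ioc.mpr ⟨(hs p hps).pos, Nat.le_floor hpy⟩, hs p hps⟩
    _ ≤ log ⌊y⌋₊ + 2 := sum_prime_log_div_le _
    _ ≤ log y + 2 := by
        have : (0 : ℝ) < ⌊y⌋₊ := by exact_mod_cast Nat.floor_pos.mpr hy
        gcongr
        exact Nat.floor_le hy0

end PrimeSums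

section EulerProduct

theorem sum_rpow_neg_le {σ : ℝ} (hσ : 1 < σ) (S : Finset ℕ) :
    ∑ m ∈ S, (m : ℝ) ^ (-σ) ≤ 1 + 1 / (σ - 1) := by
  have hsum : Summable fun m : ℕ => (m : ℝ) ^ (-σ) := summable_nat_rpow.mpr (by linarith)
  have hzeta : ∑' m : ℕ, ((m + 1 : ℕ) : ℝ) ^ (-σ) = ∑' m : ℕ, 1 / (m + 1 : ℝ) ^ σ :=
    tsum_congr fun m => by rw [rpow_neg (by positivity), one_div, Nat.cast_succ]
  have hterm : 0 ≤ ZetaAsymptotics.termTSum σ :=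
    tsum_nonneg fun n => ZetaAsymptotics.term_nonneg _ _
  calc ∑ m ∈ S, (m : ℝ) ^ (-σ) ≤ ∑' m : ℕ, (m : ℝ) ^ (-σ) :=
        hsum.sum_le_tsum S fun m _ => by positivity
    _ = ∑' m : ℕ, 1 / (m + 1 : ℝ) ^ σ := by
        rw [hsum.tsum_eq_zero_add, hzeta, Nat.cast_zero, zero_rpow (by linarith), zero_add]
    _ = 1 / (σ - 1) + 1 - σ * ZetaAsymptotics.termTSum σ := by
        linarith [ZetaAsymptotics.zeta_limit_aux1 hσ]
    _ ≤ 1 + 1 / (σ - 1) := by nlinarith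

variable {s : Finset ℕ}

theorem hasSum_factoredNumbers_rpow_neg (hs : ∀ p ∈ s, p.Prime) {σ : ℝ} (hσ : 0 < σ) :
    HasSum (fun m : Nat.factoredNumbers s => ((m : ℕ) : ℝ) ^ (-σ))
      (∏ p ∈ s, (1 - (p : ℝ) ^ (-σ))⁻¹) := by
  let f : ℕ →* ℝ :=
    { toFun := fun m => (m : ℝ) ^ (-σ)
      map_one' := by simp
      map_mul' := fun a b => by
        rw [Nat.cast_mul, mul_rpow a.cast_nonneg b.cast_nonneg] }
  have hf : ∀ {p : ℕ}, p.Prime → ‖f p‖ < 1 := fun {p} hp => by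
    change ‖(p : ℝ) ^ (-σ)‖ < 1
    rw [norm_of_nonneg (by positivity)]
    exact rpow_lt_one_of_one_lt_of_neg (by exact_mod_cast hp.one_lt) (by linarith)
  have h := (EulerProduct.summable_and_hasSum_factoredNumbers_prod_filter_prime_geometric hf s).2
  rwa [filter_true_of_mem hs] at h

theorem sum_rpow_neg_le_prod (hs : ∀ p ∈ s, p.Prime) {σ : ℝ} (hσ : 0 < σ) {S : Finset ℕ}
    (hS : ∀ m ∈ S, m ∈ Nat.factoredNumbers s) :
    ∑ m ∈ S, (m : ℝ) ^ (-σ) ≤ ∏ p ∈ s, (1 - (p : ℝ) ^ (-σ))⁻¹ := by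
  rw [← sum_subtype_of_mem (fun m : ℕ => (m : ℝ) ^ (-σ)) hS]
  exact sum_le_hasSum _ (fun _ _ => by positivity) (hasSum_factoredNumbers_rpow_neg hs hσ)

theorem prod_one_sub_rpow_neg_inv_le (hs : ∀ p ∈ s, p.Prime) {σ : ℝ} (hσ : 1 < σ) :
    ∏ p ∈ s, (1 - (p : ℝ) ^ (-σ))⁻¹ ≤ 1 + 1 / (σ - 1) := by
  refine hasSum_le_of_sum_le (hasSum_factoredNumbers_rpow_neg hs (by linarith)) fun S => ?_
  have h := sum_rpow_neg_le hσ (S.map (Function.Embedding.subtype _))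
  rwa [sum_map] at h

theorem one_sub_inv_le_mul_exp {a b : ℝ} (ha : a ≤ 3 / 4) (hba : b ≤ a) :
    (1 - a)⁻¹ ≤ (1 - b)⁻¹ * exp (4 * (a - b)) := by
  have ha1 : 0 < 1 - a := by linarith
  have hb1 : 0 < 1 - b := by linarith
  rw [inv_mul_eq_div, le_div_iff₀ hb1, inv_mul_le_iff₀ ha1]
  nlinarith [add_one_le_exp (4 * (a - b))]

theorem rpow_neg_le_three_quarters {p σ : ℝ} (hp : 2 ≤ p) (hσ : 1 / 2 ≤ σ) :
    p ^ (-σ) ≤ 3 / 4 := by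
  calc p ^ (-σ) ≤ 2 ^ (-σ) := rpow_le_rpow_of_nonpos two_pos hp (by linarith)
    _ ≤ 2 ^ (-(1 / 2 : ℝ)) := rpow_le_rpow_of_exponent_le one_le_two (by linarith)
    _ = (√2)⁻¹ := by rw [rpow_neg zero_le_two, ← sqrt_eq_rpow]
    _ ≤ 3 / 4 := by
        rw [inv_le_comm₀ (by positivity) (by norm_num)]
        exact le_sqrt_of_sq_le (by norm_num)

variable {p y δ : ℝ}

theorem rpow_sub_rpow_le_of_le {η : ℝ} (hp : 1 ≤ p) (hpy : p ≤ y) (hδ : 0 ≤ δ) (hη : 0 ≤ η) :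
    p ^ (-(1 - δ)) - p ^ (-(1 + η)) ≤ y ^ δ * (δ + η) * (log p / p) := by
  have hp0 : 0 < p := by linarith
  have hlog : 0 ≤ log p := log_nonneg hp
  have hleft : p ^ (-(1 - δ)) = p ^ δ / p := by rw [neg_sub, rpow_sub_one hp0.ne']
  have hright : p ^ (-(1 + η)) = p ^ δ / p * exp (-((δ + η) * log p)) := by
    rw [← hleft, rpow_def_of_pos hp0, rpow_def_of_pos hp0, ← exp_add]
    ring_nf
  calc p ^ (-(1 - δ)) - p ^ (-(1 + η)) = p ^ δ / p * (1 - exp (-((δ + η) * log p))) := by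
        rw [hleft, hright]; ring
    _ ≤ p ^ δ / p * ((δ + η) * log p) := by
        gcongr
        linarith [add_one_le_exp (-((δ + η) * log p))]
    _ ≤ y ^ δ / p * ((δ + η) * log p) := by gcongr
    _ = y ^ δ * (δ + η) * (log p / p) := by ring

theorem rpow_neg_le_of_lt (hy : 1 < y) (hpy : y < p) (hδ : δ ≤ 1) :
    p ^ (-(1 - δ)) ≤ y ^ δ / (y * log y) * log p := by
  have hy0 : 0 < y := by linarith
  have hlog : 0 < log y := log_pos hy
  calc p ^ (-(1 - δ)) ≤ y ^ (-(1 - δ)) := rpow_le_rpow_of_nonpos hy0 hpy.le (by linarith)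
    _ = y ^ δ / (y * log y) * log y := by
        rw [neg_sub, rpow_sub_one hy0.ne']
        field_simp
    _ ≤ y ^ δ / (y * log y) * log p := by gcongr

theorem rpow_sub_rpow_le_add (hp : 1 ≤ p) (hy : 1 < y) (hδ0 : 0 ≤ δ) (hδ1 : δ ≤ 1) :
    p ^ (-(1 - δ)) - p ^ (-(1 + 1 / log y)) ≤
      (if p ≤ y then y ^ δ * (δ + 1 / log y) * (log p / p) else 0) +
        y ^ δ / (y * log y) * log p := by
  have hlogp : 0 ≤ log p := log_nonneg hp
  have hlogy : 0 < log y := log_pos hy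
  split_ifs with hpy
  · have hlarge : 0 ≤ y ^ δ / (y * log y) * log p := by positivity
    linarith [rpow_sub_rpow_le_of_le hp hpy hδ0 (one_div_pos.mpr hlogy).le]
  · have hsub : 0 ≤ p ^ (-(1 + 1 / log y)) := by positivity
    linarith [rpow_neg_le_of_lt hy (not_le.mp hpy) hδ1]

theorem sum_rpow_sub_rpow_le (hs : ∀ p ∈ s, p.Prime) (hsy : ∑ p ∈ s, log p ≤ y)
    (hy : exp 1 ≤ y) (hδ0 : 0 ≤ δ) (hδ1 : δ ≤ 1) :
    ∑ p ∈ s, ((p : ℝ) ^ (-(1 - δ)) - (p : ℝ) ^ (-(1 + 1 / log y))) ≤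
      4 * (y ^ δ * (δ * log y + 1)) := by
  have hy0 : 0 < y := (exp_pos 1).trans_le hy
  have hlog : 1 ≤ log y := (le_log_iff_exp_le hy0).mpr hy
  have hy1 : 1 < y := (one_lt_exp_iff.mpr one_pos).trans_le hy
  calc ∑ p ∈ s, ((p : ℝ) ^ (-(1 - δ)) - (p : ℝ) ^ (-(1 + 1 / log y)))
      ≤ ∑ p ∈ s, ((if (p : ℝ) ≤ y then y ^ δ * (δ + 1 / log y) * (log p / p) else 0) +
          y ^ δ / (y * log y) * log p) :=
        sum_le_sum fun p hp =>
          rpow_sub_rpow_le_add (by exact_mod_cast (hs p hp).one_le) hy1 hδ0 hδ1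
    _ = y ^ δ * (δ + 1 / log y) * ∑ p ∈ s with ((p : ℕ) : ℝ) ≤ y, log p / p +
          y ^ δ / (y * log y) * ∑ p ∈ s, log p := by
        rw [sum_add_distrib, ← sum_filter, ← mul_sum, ← mul_sum]
    _ ≤ y ^ δ * (δ + 1 / log y) * (3 * log y) + y ^ δ / (y * log y) * y := by
        gcongr
        linarith [sum_filter_log_div_le hs hy1.le]
    _ = y ^ δ * (3 * (δ * log y + 1) + 1 / log y) := by field_simp
    _ ≤ y ^ δ * (3 * (δ * log y + 1) + (δ * log y + 1)) := by
        gcongr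
        linarith [div_le_one_of_le₀ hlog (by linarith), mul_nonneg hδ0 (zero_le_one.trans hlog)]
    _ = 4 * (y ^ δ * (δ * log y + 1)) := by ring

-- Comparing with the exponent `1 + 1 / log y` costs only `exp (O (y ^ δ (δ log y + 1)))`, and
-- there the whole product is at most `ζ (1 + 1 / log y) ≤ 1 + log y`.
theorem prod_one_sub_rpow_inv_le_mul_exp (hs : ∀ p ∈ s, p.Prime) (hsy : ∑ p ∈ s, log p ≤ y)
    (hy : exp 1 ≤ y) (hδ0 : 0 ≤ δ) (hδ : δ ≤ 1 / 2) :
    ∏ p ∈ s, (1 - (p : ℝ) ^ (-(1 - δ)))⁻¹ ≤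
      (1 + log y) * exp (16 * (y ^ δ * (δ * log y + 1))) := by
  have hlog : 0 < log y := log_pos ((one_lt_exp_iff.mpr one_pos).trans_le hy)
  have hη : 0 < 1 / log y := one_div_pos.mpr hlog
  have hthree : ∀ p ∈ s, (p : ℝ) ^ (-(1 - δ)) ≤ 3 / 4 := fun p hp =>
    rpow_neg_le_three_quarters (by exact_mod_cast (hs p hp).two_le) (by linarith)
  have hzeta := prod_one_sub_rpow_neg_inv_le hs (lt_add_of_pos_right 1 hη)
  rw [add_sub_cancel_left, one_div_one_div] at hzeta
  calc ∏ p ∈ s, (1 - (p : ℝ) ^ (-(1 - δ)))⁻¹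
      ≤ ∏ p ∈ s, ((1 - (p : ℝ) ^ (-(1 + 1 / log y)))⁻¹ *
          exp (4 * ((p : ℝ) ^ (-(1 - δ)) - (p : ℝ) ^ (-(1 + 1 / log y))))) := by
        refine prod_le_prod (fun p hp => inv_nonneg.mpr (by linarith [hthree p hp])) fun p hp =>
          one_sub_inv_le_mul_exp (hthree p hp) (rpow_le_rpow_of_exponent_le ?_ (by linarith))
        exact_mod_cast (hs p hp).one_le
    _ = (∏ p ∈ s, (1 - (p : ℝ) ^ (-(1 + 1 / log y)))⁻¹) *
          exp (4 * ∑ p ∈ s, ((p : ℝ) ^ (-(1 - δ)) - (p : ℝ) ^ (-(1 + 1 / log y)))) := by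
        rw [prod_mul_distrib, mul_sum, exp_sum]
    _ ≤ (1 + log y) * exp (16 * (y ^ δ * (δ * log y + 1))) := by
        refine mul_le_mul hzeta (exp_le_exp.mpr ?_) (exp_pos _).le (by linarith)
        linarith [sum_rpow_sub_rpow_le hs hsy hy hδ0 (by linarith)]

end EulerProduct

section FactoredNumbers

/-- The `s`-factored numbers up to `N`: the integers in `[1, N]` all of whose prime factors lie in
`s`. The analogue of `Nat.smoothNumbersUpTo` for `Nat.factoredNumbers`. -/
def factoredNumbersUpTo (N : ℕ) (s : Finset ℕ) : Finset ℕ :=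
  {m ∈ Ioc 0 N | m ∈ Nat.factoredNumbers s}

/-- The indicator function of the `s`-factored numbers, as an arithmetic function, so that the
Dirichlet convolution of `ArithmeticFunction` applies to it. -/
noncomputable def factoredIndicator (s : Finset ℕ) : ArithmeticFunction ℝ where
  toFun m := if m ∈ Nat.factoredNumbers s then 1 else 0
  map_zero' := if_neg fun h => Nat.ne_zero_of_mem_factoredNumbers h rfl

variable {s : Finset ℕ} {y z δ T : ℝ}

theorem mul_mem_factoredNumbers_iff {a b : ℕ} :
    a * b ∈ Nat.factoredNumbers s ↔ a ∈ Nat.factoredNumbers s ∧ b ∈ Nat.factoredNumbers s :=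
  ⟨fun h => ⟨Nat.mem_factoredNumbers_of_dvd h (dvd_mul_right a b),
    Nat.mem_factoredNumbers_of_dvd h (dvd_mul_left b a)⟩,
    fun h => Nat.mul_mem_factoredNumbers h.1 h.2⟩

theorem factoredIndicator_mul (a b : ℕ) :
    factoredIndicator s (a * b) = factoredIndicator s a * factoredIndicator s b := by
  simp only [factoredIndicator, ArithmeticFunction.coe_mk, mul_mem_factoredNumbers_iff, ite_and,
    ite_mul, one_mul, zero_mul]

theorem factoredIndicator_pmul_mul (f g : ArithmeticFunction ℝ) :
    (factoredIndicator s).pmul (f * g) =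
      (factoredIndicator s).pmul f * (factoredIndicator s).pmul g := by
  ext n
  simp only [ArithmeticFunction.pmul_apply, ArithmeticFunction.mul_apply, mul_sum]
  refine sum_congr rfl fun x hx => ?_
  rw [← (Nat.mem_divisorsAntidiagonal.mp hx).1, factoredIndicator_mul]
  ring

theorem sum_factoredIndicator_mul (f : ℕ → ℝ) (N : ℕ) :
    ∑ m ∈ Ioc 0 N, factoredIndicator s m * f m = ∑ m ∈ factoredNumbersUpTo N s, f m := by
  simp only [factoredIndicator, ArithmeticFunction.coe_mk, ite_mul, one_mul, zero_mul,
    factoredNumbersUpTo, sum_filter]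

-- The identity `log = ζ * Λ` survives multiplication by a completely multiplicative function.
theorem sum_log_factoredNumbersUpTo (s : Finset ℕ) (N : ℕ) :
    ∑ t ∈ factoredNumbersUpTo N s, log t =
      ∑ m ∈ factoredNumbersUpTo N s, ∑ d ∈ factoredNumbersUpTo (N / m) s, Λ d := by
  calc ∑ t ∈ factoredNumbersUpTo N s, log t
      = ∑ t ∈ Ioc 0 N, (factoredIndicator s).pmul (ζ * Λ) t := by
        rw [ArithmeticFunction.zeta_mul_vonMangoldt, ← sum_factoredIndicator_mul]
        rfl
    _ = ∑ m ∈ Ioc 0 N, factoredIndicator s m *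
          ∑ d ∈ Ioc 0 (N / m), factoredIndicator s d * Λ d := by
        rw [factoredIndicator_pmul_mul, ArithmeticFunction.pmul_zeta,
          ArithmeticFunction.sum_Ioc_mul_eq_sum_sum]
        rfl
    _ = _ := by simp only [sum_factoredIndicator_mul]

theorem min_le_rpow_mul_rpow (hy : 0 < y) (hz : 0 < z) (hδ0 : 0 ≤ δ) (hδ1 : δ ≤ 1) :
    min z y ≤ y ^ δ * z ^ (1 - δ) := by
  have hmin : 0 < min z y := lt_min hz hy
  calc min z y = min z y ^ δ * min z y ^ (1 - δ) := by
        rw [← rpow_add hmin, add_sub_cancel, rpow_one]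
    _ ≤ y ^ δ * z ^ (1 - δ) := by
        gcongr
        · exact min_le_right z y
        · exact min_le_left z y

theorem sum_filter_log_le_min (hs : ∀ p ∈ s, p.Prime) (hsy : ∑ p ∈ s, log p ≤ y) (hz : 0 ≤ z) :
    ∑ p ∈ s with p ≤ ⌊z⌋₊, log p ≤ min (2 * z) y := by
  refine le_min (le_trans ?_ (theta_le_two_mul hz)) (le_trans ?_ hsy)
  · refine sum_le_sum_of_subset_of_nonneg (fun p hp => ?_) fun p _ _ => log_natCast_nonneg p
    obtain ⟨hps, hpz⟩ := mem_filter.mp hp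
    exact mem_filter.mpr ⟨mem_Ioc.mpr ⟨(hs p hps).pos, hpz⟩, hs p hps⟩
  · exact sum_le_sum_of_subset_of_nonneg (filter_subset _ _) fun p _ _ => log_natCast_nonneg p

theorem psi_sub_theta_le_rpow (hδ : δ ≤ 1 / 4) (hz : 1 ≤ z) : ψ z - θ z ≤ 8 * z ^ (1 - δ) := by
  have hz0 : 0 < z := by linarith
  have hlog : log z ≤ 4 * z ^ (1 / 4 : ℝ) := by
    linarith [log_le_rpow_div hz0.le (ε := 1 / 4) (by norm_num)]
  calc ψ z - θ z ≤ 2 * √z * log z := Chebyshev.psi_sub_theta_le hz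
    _ ≤ 2 * √z * (4 * z ^ (1 / 4 : ℝ)) := by gcongr
    _ = 8 * (z ^ (1 / 2 : ℝ) * z ^ (1 / 4 : ℝ)) := by rw [sqrt_eq_rpow]; ring
    _ = 8 * z ^ (3 / 4 : ℝ) := by rw [← rpow_add hz0]; norm_num
    _ ≤ 8 * z ^ (1 - δ) := by
        gcongr
        linarith

theorem sum_vonMangoldt_factoredNumbersUpTo_le_add (s : Finset ℕ) (z : ℝ) :
    ∑ d ∈ factoredNumbersUpTo ⌊z⌋₊ s, Λ d ≤ ∑ p ∈ s with p ≤ ⌊z⌋₊, log p + (ψ z - θ z) := by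
  rw [Chebyshev.psi_sub_theta_eq_sum_not_prime, ← sum_filter_add_sum_filter_not _ Nat.Prime]
  refine add_le_add ?_ ?_
  · calc ∑ p ∈ factoredNumbersUpTo ⌊z⌋₊ s with p.Prime, Λ p
        = ∑ p ∈ factoredNumbersUpTo ⌊z⌋₊ s with p.Prime, log p :=
          sum_congr rfl fun p hp =>
            ArithmeticFunction.vonMangoldt_apply_prime (mem_filter.mp hp).2
      _ ≤ ∑ p ∈ s with p ≤ ⌊z⌋₊, log p := by
          refine sum_le_sum_of_subset_of_nonneg (fun p hp => ?_) fun p _ _ => log_natCast_nonneg p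
          simp only [factoredNumbersUpTo, mem_filter, mem_Ioc] at hp ⊢
          exact ⟨Nat.mem_factoredNumbers'.mp hp.1.2 p hp.2 dvd_rfl, hp.1.1.2⟩
  · exact sum_le_sum_of_subset_of_nonneg (filter_subset_filter _ (filter_subset _ _))
      fun _ _ _ => ArithmeticFunction.vonMangoldt_nonneg

theorem sum_vonMangoldt_factoredNumbersUpTo_le (hs : ∀ p ∈ s, p.Prime)
    (hsy : ∑ p ∈ s, log p ≤ y) (hy : 1 ≤ y) (hδ0 : 0 ≤ δ) (hδ : δ ≤ 1 / 4) (hz : 1 ≤ z) :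
    ∑ d ∈ factoredNumbersUpTo ⌊z⌋₊ s, Λ d ≤ 10 * (y ^ δ * z ^ (1 - δ)) := by
  have hy0 : 0 < y := by linarith
  have hz0 : 0 < z := by linarith
  have hprimes : ∑ p ∈ s with p ≤ ⌊z⌋₊, log p ≤ 2 * (y ^ δ * z ^ (1 - δ)) := by
    calc ∑ p ∈ s with p ≤ ⌊z⌋₊, log p ≤ min (2 * z) y := sum_filter_log_le_min hs hsy hz0.le
      _ ≤ min (2 * z) (2 * y) := min_le_min_left _ (by linarith)
      _ = 2 * min z y := (mul_min_of_nonneg z y zero_le_two).symm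
      _ ≤ 2 * (y ^ δ * z ^ (1 - δ)) := by
          gcongr
          exact min_le_rpow_mul_rpow hy0 hz0 hδ0 (by linarith)
  have hpowers : ψ z - θ z ≤ 8 * (y ^ δ * z ^ (1 - δ)) :=
    (psi_sub_theta_le_rpow hδ hz).trans <| by
      gcongr
      exact le_mul_of_one_le_left (by positivity) (one_le_rpow hy hδ0)
  linarith [sum_vonMangoldt_factoredNumbersUpTo_le_add s z]

theorem mem_factoredNumbersUpTo_floor (hT : 0 ≤ T) {m : ℕ} :
    m ∈ factoredNumbersUpTo ⌊T⌋₊ s ↔ (0 < m ∧ (m : ℝ) ≤ T) ∧ m ∈ Nat.factoredNumbers s := by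
  rw [factoredNumbersUpTo, mem_filter, mem_Ioc, Nat.le_floor_iff hT]

theorem sum_div_rpow_factoredNumbersUpTo_le (hs : ∀ p ∈ s, p.Prime) {σ : ℝ} (hσ : 0 < σ)
    (hT : 0 ≤ T) :
    ∑ m ∈ factoredNumbersUpTo ⌊T⌋₊ s, (T / m) ^ σ ≤
      T ^ σ * ∏ p ∈ s, (1 - (p : ℝ) ^ (-σ))⁻¹ := by
  calc ∑ m ∈ factoredNumbersUpTo ⌊T⌋₊ s, (T / m) ^ σ
      = T ^ σ * ∑ m ∈ factoredNumbersUpTo ⌊T⌋₊ s, (m : ℝ) ^ (-σ) := by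
        rw [mul_sum]
        exact sum_congr rfl fun m _ => by
          rw [div_rpow hT m.cast_nonneg, rpow_neg m.cast_nonneg, div_eq_mul_inv]
    _ ≤ T ^ σ * ∏ p ∈ s, (1 - (p : ℝ) ^ (-σ))⁻¹ := by
        gcongr
        exact sum_rpow_neg_le_prod hs hσ fun m hm => (mem_filter.mp hm).2

-- Rankin's trick applied to `∑ log t + ∑ log (T / t)` instead of `∑ 1` saves a factor `log T`.
theorem card_factoredNumbersUpTo_mul_log_le (hs : ∀ p ∈ s, p.Prime) (hsy : ∑ p ∈ s, log p ≤ y)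
    (hy : 1 ≤ y) (hδ0 : 0 ≤ δ) (hδ : δ ≤ 1 / 4) (hT : 0 < T) :
    #(factoredNumbersUpTo ⌊T⌋₊ s) * log T ≤
      12 * (y ^ δ * T ^ (1 - δ)) * ∏ p ∈ s, (1 - (p : ℝ) ^ (-(1 - δ)))⁻¹ := by
  have hyδ : 1 ≤ y ^ δ := one_le_rpow hy hδ0
  set S := factoredNumbersUpTo ⌊T⌋₊ s with hS
  have hmem : ∀ m ∈ S, (0 : ℝ) < m ∧ 1 ≤ T / m := fun m hm => by
    obtain ⟨⟨hm0, hmT⟩, -⟩ := (mem_factoredNumbersUpTo_floor hT.le).mp hm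
    exact ⟨by exact_mod_cast hm0, (one_le_div (by exact_mod_cast hm0)).mpr hmT⟩
  have hlog : ∑ t ∈ S, log t ≤ ∑ m ∈ S, 10 * (y ^ δ * (T / m) ^ (1 - δ)) := by
    rw [hS, sum_log_factoredNumbersUpTo]
    refine sum_le_sum fun m hm => ?_
    rw [← Nat.floor_div_natCast]
    exact sum_vonMangoldt_factoredNumbersUpTo_le hs hsy hy hδ0 hδ (hmem m hm).2
  have hlog_div : ∑ t ∈ S, log (T / t) ≤ ∑ m ∈ S, 2 * (y ^ δ * (T / m) ^ (1 - δ)) := by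
    refine sum_le_sum fun m hm => ?_
    have hTm : 0 ≤ T / m := zero_le_one.trans (hmem m hm).2
    calc log (T / m) ≤ (T / m) ^ (1 - δ) / (1 - δ) := log_le_rpow_div hTm (by linarith)
      _ ≤ (T / m) ^ (1 - δ) / (1 / 2) := by
          gcongr
          linarith
      _ = 2 * (1 * (T / m) ^ (1 - δ)) := by ring
      _ ≤ 2 * (y ^ δ * (T / m) ^ (1 - δ)) := by gcongr
  calc #S * log T = ∑ t ∈ S, log t + ∑ t ∈ S, log (T / t) := by
        rw [← sum_add_distrib, ← nsmul_eq_mul, ← sum_const]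
        refine sum_congr rfl fun t ht => ?_
        rw [log_div hT.ne' (hmem t ht).1.ne', add_sub_cancel]
    _ ≤ 12 * y ^ δ * ∑ m ∈ S, (T / m) ^ (1 - δ) := by
        rw [← mul_sum, ← mul_sum] at hlog hlog_div
        linarith
    _ ≤ 12 * y ^ δ * (T ^ (1 - δ) * ∏ p ∈ s, (1 - (p : ℝ) ^ (-(1 - δ)))⁻¹) := by
        gcongr
        exact sum_div_rpow_factoredNumbersUpTo_le hs (by linarith) hT.le
    _ = 12 * (y ^ δ * T ^ (1 - δ)) * ∏ p ∈ s, (1 - (p : ℝ) ^ (-(1 - δ)))⁻¹ := by ring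

theorem mul_le_exp_five_mul {w E : ℝ} (hw : 1 ≤ w) (hwE : w ≤ E) : 24 * w ≤ exp (5 * E) := by
  have h24 : 24 ≤ exp 4 := by
    calc (24 : ℝ) ≤ 2.7 ^ 4 := by norm_num
      _ ≤ exp 1 ^ 4 := by
          gcongr
          linarith [exp_one_gt_d9]
      _ = exp 4 := by rw [← exp_nat_mul]; norm_num
  calc 24 * w ≤ exp 4 * exp w := by
        gcongr
        linarith [add_one_le_exp w]
    _ = exp (4 + w) := (exp_add 4 w).symm
    _ ≤ exp (5 * E) := exp_le_exp.mpr (by linarith)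

theorem card_factoredNumbersUpTo_le_rpow_mul_exp (hs : ∀ p ∈ s, p.Prime)
    (hsy : ∑ p ∈ s, log p ≤ y) (hy : exp 1 ≤ y) (hyT : y ≤ T) (hδ0 : 0 ≤ δ) (hδ : δ ≤ 1 / 4) :
    #(factoredNumbersUpTo ⌊T⌋₊ s) ≤ T ^ (1 - δ) * exp (21 * (y ^ δ * (δ * log y + 1))) := by
  have hy0 : 0 < y := (exp_pos 1).trans_le hy
  have hy1 : 1 ≤ y := (one_le_exp zero_le_one).trans hy
  have hT0 : 0 < T := hy0.trans_le hyT
  have hlogy : 1 ≤ log y := (le_log_iff_exp_le hy0).mpr hy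
  have hlogT : log y ≤ log T := log_le_log hy0 hyT
  have hlogT0 : 0 < log T := by linarith
  set E := y ^ δ * (δ * log y + 1)
  have hE : y ^ δ ≤ E := le_mul_of_one_le_right (by positivity) (by nlinarith)
  refine le_of_mul_le_mul_right ?_ hlogT0
  calc #(factoredNumbersUpTo ⌊T⌋₊ s) * log T
      ≤ 12 * (y ^ δ * T ^ (1 - δ)) * ∏ p ∈ s, (1 - (p : ℝ) ^ (-(1 - δ)))⁻¹ :=
        card_factoredNumbersUpTo_mul_log_le hs hsy hy1 hδ0 hδ hT0
    _ ≤ 12 * (y ^ δ * T ^ (1 - δ)) * ((1 + log y) * exp (16 * E)) := by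
        gcongr
        exact prod_one_sub_rpow_inv_le_mul_exp hs hsy hy hδ0 (by linarith)
    _ ≤ 12 * (y ^ δ * T ^ (1 - δ)) * ((2 * log T) * exp (16 * E)) := by
        gcongr
        linarith
    _ = T ^ (1 - δ) * (24 * y ^ δ * exp (16 * E)) * log T := by ring
    _ ≤ T ^ (1 - δ) * (exp (5 * E) * exp (16 * E)) * log T := by
        gcongr
        exact mul_le_exp_five_mul (one_le_rpow hy1 hδ0) hE
    _ = T ^ (1 - δ) * exp (21 * E) * log T := by rw [← exp_add]; ring_nf

end FactoredNumbers

section Asymptotics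

variable {A ε : ℝ}

theorem card_factoredNumbersUpTo_le_mul_exp {s : Finset ℕ} (hs : ∀ p ∈ s, p.Prime) {y w T : ℝ}
    (hsy : ∑ p ∈ s, log p ≤ y) (hy : exp 1 ≤ y) (hyT : y ≤ T) (hw : 1 ≤ w) (hwy : w ^ 4 ≤ y) :
    #(factoredNumbersUpTo ⌊T⌋₊ s) ≤
      T * exp (21 * (w * (log w + 1)) - log T / log y * log w) := by
  have hy0 : 0 < y := (exp_pos 1).trans_le hy
  have hT0 : 0 < T := hy0.trans_le hyT
  have hw0 : 0 < w := by linarith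
  have hlogy : 0 < log y := zero_lt_one.trans_le ((le_log_iff_exp_le hy0).mpr hy)
  have hlogw : 0 ≤ log w := log_nonneg hw
  set δ := log w / log y with hδ
  have hδlog : δ * log y = log w := div_mul_cancel₀ _ hlogy.ne'
  have hyδ : y ^ δ = w := by rw [rpow_def_of_pos hy0, mul_comm, hδlog, exp_log hw0]
  have hδ4 : δ ≤ 1 / 4 := by
    have h : log (w ^ 4) ≤ log y := log_le_log (by positivity) hwy
    rw [log_pow] at h
    rw [hδ, div_le_iff₀ hlogy]
    push_cast at h
    linarith
  calc (#(factoredNumbersUpTo ⌊T⌋₊ s) : ℝ)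
      ≤ T ^ (1 - δ) * exp (21 * (y ^ δ * (δ * log y + 1))) :=
        card_factoredNumbersUpTo_le_rpow_mul_exp hs hsy hy hyT (by positivity) hδ4
    _ = T * exp (21 * (w * (log w + 1)) - log T / log y * log w) := by
        rw [hyδ, hδlog, sub_eq_add_neg, rpow_add hT0, rpow_one, rpow_def_of_pos hT0, mul_assoc,
          ← exp_add, hδ]
        ring_nf

theorem eventually_rpow_mul_log_le {c k : ℝ} (hc : c < 1) (hk : 0 < k) :
    ∀ᶠ L in atTop, L ^ c * (c * log L + 1) ≤ k * L := by
  have hc' : 0 < 1 - c := sub_pos.mpr hc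
  filter_upwards [(isLittleO_log_rpow_atTop hc').bound (half_pos hk),
    (tendsto_rpow_atTop hc').eventually_ge_atTop (2 / k), eventually_ge_atTop 1]
    with L hlog hone hL
  have hL0 : 0 < L := by linarith
  rw [norm_of_nonneg (log_nonneg hL), norm_of_nonneg (by positivity)] at hlog
  have hfactor : c * log L + 1 ≤ k * L ^ (1 - c) := by
    rw [div_le_iff₀ hk] at hone
    nlinarith [log_nonneg hL]
  calc L ^ c * (c * log L + 1) ≤ L ^ c * (k * L ^ (1 - c)) := by gcongr
    _ = k * (L ^ c * L ^ (1 - c)) := by ring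
    _ = k * L := by rw [← rpow_add hL0, add_sub_cancel, rpow_one]

theorem eventually_one_le_mul_div_log {k : ℝ} (hk : 0 < k) :
    ∀ᶠ L in atTop, 1 ≤ k * (L / log L) := by
  filter_upwards [isLittleO_log_id_atTop.bound hk, eventually_gt_atTop 1] with L hlog hL
  have hL0 : 0 < L := by linarith
  rw [norm_of_nonneg (log_nonneg hL.le), id, norm_of_nonneg hL0.le] at hlog
  rwa [← mul_div_assoc, one_le_div (log_pos hL)]

-- With `c = (1 + ε / 2) / (1 + ε)` the hypothesis on `u` gives `u c log L ≥ (1 + ε / 2) A L`. Half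
-- of the margin `ε / 2` absorbs the Euler product, the other half absorbs `A log u`.
theorem eventually_exponent_le (hA : 0 < A) (hε : 0 < ε) :
    ∃ c, 0 < c ∧ c < 1 ∧ ∀ᶠ L in atTop, ∀ u, (1 + ε) * A * (L / log L) ≤ u → 1 ≤ u →
      21 * (L ^ c * (c * log L + 1)) + A * (log u + L) ≤ u * (c * log L) := by
  have hε1 : 0 < 1 + ε := by linarith
  have hc1 : (1 + ε / 2) / (1 + ε) < 1 := by
    rw [div_lt_one hε1]
    linarith
  refine ⟨(1 + ε / 2) / (1 + ε), by positivity, hc1, ?_⟩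
  filter_upwards [eventually_rpow_mul_log_le hc1 (show 0 < ε / 4 * A / 21 by positivity),
    eventually_gt_atTop 1, tendsto_log_atTop.eventually_ge_atTop (A * (1 + ε) / (ε / 4))]
    with L heuler hL hlogL u hu hu1
  have hlogL0 : 0 < log L := log_pos hL
  have hlogu : A * log u ≤ ε / 4 / (1 + ε) * log L * u := by
    have hAL : A ≤ ε / 4 / (1 + ε) * log L := by
      rw [div_le_iff₀ (by positivity)] at hlogL
      rw [div_mul_eq_mul_div, le_div_iff₀ hε1]
      linarith
    have hlogu0 : 0 ≤ log u := log_nonneg hu1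
    gcongr
    exact log_le_self (by linarith)
  have hmain : (1 + ε / 4) * A * L ≤ (1 + ε / 4) / (1 + ε) * log L * u := by
    calc (1 + ε / 4) * A * L
        = (1 + ε / 4) / (1 + ε) * log L * ((1 + ε) * A * (L / log L)) := by field_simp
      _ ≤ (1 + ε / 4) / (1 + ε) * log L * u := by gcongr
  calc 21 * (L ^ ((1 + ε / 2) / (1 + ε)) * ((1 + ε / 2) / (1 + ε) * log L + 1)) + A * (log u + L)
      ≤ ε / 4 * A * L + (A * log u + A * L) := by linarith
    _ ≤ (1 + ε / 4) / (1 + ε) * log L * u + ε / 4 / (1 + ε) * log L * u := by linarith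
    _ = u * ((1 + ε / 2) / (1 + ε) * log L) := by
        field_simp
        ring

theorem eventually_log_log_rpow_pow_four_le {c : ℝ} (hc : c ≤ 1) :
    ∀ᶠ y in atTop, (log (log y) ^ c) ^ 4 ≤ y := by
  have hloglog := tendsto_log_atTop.comp tendsto_log_atTop
  have hpow := hloglog.eventually ((isLittleO_pow_exp_atTop (n := 4)).bound one_pos)
  filter_upwards [hpow, hloglog.eventually_ge_atTop 1, tendsto_log_atTop.eventually_gt_atTop 0,
    eventually_ge_atTop 0] with y hpow hL hlogy hy
  simp only [Function.comp_apply, one_mul] at hpow hL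
  rw [norm_of_nonneg (by positivity), norm_of_nonneg (exp_pos _).le] at hpow
  calc (log (log y) ^ c) ^ 4 ≤ log (log y) ^ 4 := by
        gcongr
        exact rpow_le_self_of_one_le hL hc
    _ ≤ exp (log (log y)) := hpow
    _ = log y := exp_log hlogy
    _ ≤ y := log_le_self hy

theorem eventually_card_factoredNumbersUpTo_le (hA : 0 < A) (hε : 0 < ε) :
    ∀ᶠ y in atTop, ∀ s : Finset ℕ, (∀ p ∈ s, p.Prime) → ∑ p ∈ s, log p ≤ y →
      ∀ T, y ^ ((1 + ε) * A * (log (log y) / log (log (log y)))) ≤ T →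
        #(factoredNumbersUpTo ⌊T⌋₊ s) ≤ T / log T ^ A := by
  obtain ⟨c, hc0, hc1, hexponent⟩ := eventually_exponent_le hA hε
  have hloglog : Tendsto (fun y => log (log y)) atTop atTop :=
    tendsto_log_atTop.comp tendsto_log_atTop
  filter_upwards [hloglog.eventually hexponent, eventually_log_log_rpow_pow_four_le hc1.le,
    hloglog.eventually (eventually_one_le_mul_div_log (show 0 < (1 + ε) * A by positivity)),
    hloglog.eventually_ge_atTop 1, tendsto_log_atTop.eventually_ge_atTop 1,
    eventually_ge_atTop (exp 1)] with y hexponent hwy hone hL hlogy hy s hs hsy T hT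
  set L := log (log y)
  have hy0 : 0 < y := (exp_pos 1).trans_le hy
  have hlogy0 : 0 < log y := by linarith
  have hL0 : 0 < L := by linarith
  have hT0 : 0 < T := (rpow_pos_of_pos hy0 _).trans_le hT
  set u := log T / log y
  have hu : (1 + ε) * A * (L / log L) ≤ u := by
    rw [le_div_iff₀ hlogy0, ← log_rpow hy0]
    exact log_le_log (rpow_pos_of_pos hy0 _) hT
  have hu1 : 1 ≤ u := hone.trans hu
  have hyT : y ≤ T := by
    rwa [one_le_div hlogy0, log_le_log_iff hy0 hT0] at hu1
  have hlogT : log T ^ A = exp (A * (log u + L)) := by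
    have hlogT_eq : log T = u * log y := (div_mul_cancel₀ _ hlogy0.ne').symm
    rw [hlogT_eq, rpow_def_of_pos (by positivity), log_mul (by positivity) hlogy0.ne', mul_comm]
  calc (#(factoredNumbersUpTo ⌊T⌋₊ s) : ℝ)
      ≤ T * exp (21 * (L ^ c * (log (L ^ c) + 1)) - u * log (L ^ c)) :=
        card_factoredNumbersUpTo_le_mul_exp hs hsy hy hyT (one_le_rpow hL hc0.le) hwy
    _ ≤ T * exp (-(A * (log u + L))) := by
        rw [log_rpow hL0]
        gcongr
        linarith [hexponent u hu hu1]
    _ = T / log T ^ A := by rw [hlogT, exp_neg, div_eq_mul_inv]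

end Asymptotics

section Binomials

variable {F : Type*} [Field F] [Finite F]

theorem mem_factoredNumbers_of_irreducible {t : ℕ} {a : F} (ha : a ≠ 0)
    (h : Irreducible (Polynomial.X ^ t - Polynomial.C a)) :
    t ∈ Nat.factoredNumbers (Nat.card F - 1).primeFactors := by
  rw [Nat.mem_factoredNumbers']
  intro p hp hpt
  refine Nat.mem_primeFactors.mpr ⟨hp, ?_, (Nat.sub_pos_of_lt Finite.one_lt_card).ne'⟩
  by_contra hpq
  have hcoprime : (Nat.card Fˣ).Coprime p := by
    rw [Nat.card_units]
    exact (hp.coprime_iff_not_dvd.mpr hpq).symm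
  obtain ⟨b, hb⟩ := (powCoprime hcoprime).surjective (Units.mk0 a ha)
  exact pow_ne_of_irreducible_X_pow_sub_C h hpt hp.ne_one (b : F) (congrArg Units.val hb)

theorem numIrreducibleBinomials_eq_zero {t : ℕ}
    (ht : t ∉ Nat.factoredNumbers (Nat.card F - 1).primeFactors) :
    numIrreducibleBinomials F t = 0 := by
  have hempty : irreducibleBinomials F t = ∅ := by
    refine Set.eq_empty_of_forall_notMem ?_
    rintro _ ⟨hf, a, ha, rfl⟩
    exact ht (mem_factoredNumbers_of_irreducible ha hf)
  rw [numIrreducibleBinomials, hempty, Set.ncard_empty]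

theorem numIrreducibleBinomials_le (t : ℕ) : numIrreducibleBinomials F t ≤ Nat.card F - 1 := by
  have hsub : irreducibleBinomials F t ⊆
      Set.range fun a : Fˣ => Polynomial.X ^ t - Polynomial.C (a : F) := by
    rintro _ ⟨-, a, ha, rfl⟩
    exact ⟨Units.mk0 a ha, rfl⟩
  calc numIrreducibleBinomials F t
      ≤ (Set.range fun a : Fˣ => Polynomial.X ^ t - Polynomial.C (a : F)).ncard :=
        Set.ncard_le_ncard hsub (Set.toFinite _)
    _ ≤ Nat.card Fˣ := Finite.card_range_le _
    _ = Nat.card F - 1 := Nat.card_units F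

theorem sum_numIrreducibleBinomials_le (N : ℕ) :
    ∑ t ∈ Icc 1 N, (numIrreducibleBinomials F t : ℝ) ≤
      (Nat.card F - 1) * #(factoredNumbersUpTo N (Nat.card F - 1).primeFactors) := by
  have hcard : 0 < Nat.card F := Nat.card_pos
  calc ∑ t ∈ Icc 1 N, (numIrreducibleBinomials F t : ℝ)
      = ∑ t ∈ factoredNumbersUpTo N (Nat.card F - 1).primeFactors,
          (numIrreducibleBinomials F t : ℝ) := by
        refine (sum_filter_of_ne fun t _ ht => ?_).symm
        contrapose! ht
        rw [numIrreducibleBinomials_eq_zero ht, Nat.cast_zero]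
    _ ≤ #(factoredNumbersUpTo N (Nat.card F - 1).primeFactors) • ((Nat.card F - 1 : ℕ) : ℝ) :=
        sum_le_card_nsmul _ _ _ fun t _ => by exact_mod_cast numIrreducibleBinomials_le t
    _ = (Nat.card F - 1) * #(factoredNumbersUpTo N (Nat.card F - 1).primeFactors) := by
        rw [nsmul_eq_mul, Nat.cast_pred hcard, mul_comm]

end Binomials

section TruncatedLog

variable {x a b : ℝ}

theorem truncLog_eq_log (hx : 2 ≤ log x) : truncLog x = log x :=
  max_eq_left hx

theorem log_le_truncLog (ha : 0 < a) (hab : a ≤ b) : log a ≤ truncLog b :=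
  (log_le_log ha hab).trans (le_max_left _ _)

theorem div_log_monotoneOn : MonotoneOn (fun x => x / log x) (Set.Ici (exp 1)) := by
  intro a ha b hb hab
  have hlog : ∀ x ∈ Set.Ici (exp 1), 0 < log x / x := fun x hx =>
    div_pos (log_pos ((one_lt_exp_iff.mpr one_pos).trans_le hx)) ((exp_pos 1).trans_le hx)
  simpa only [one_div_div] using
    one_div_le_one_div_of_le (hlog b hb) (log_div_self_antitoneOn ha hb hab)

theorem eventually_div_log_le_iterTruncLog :
    ∀ᶠ x in atTop, log (log (log x)) / log (log (log (log x))) ≤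
      iterTruncLog 3 (x + 1) / iterTruncLog 4 (x + 1) := by
  have hloglog := tendsto_log_atTop.comp tendsto_log_atTop
  filter_upwards [eventually_gt_atTop 0, tendsto_log_atTop.eventually_gt_atTop 0,
    hloglog.eventually_gt_atTop 0, (tendsto_log_atTop.comp hloglog).eventually_ge_atTop (exp 2)]
    with x hx0 hx1 hx2 hx3
  simp only [Function.comp_apply] at hx2 hx3
  have h₃ : log (log (log x)) ≤ iterTruncLog 3 (x + 1) :=
    log_le_truncLog hx2 <| log_le_truncLog hx1 <| log_le_truncLog hx0 (lt_add_one x).le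
  have h₄ : iterTruncLog 4 (x + 1) = log (iterTruncLog 3 (x + 1)) :=
    truncLog_eq_log <| (le_log_iff_exp_le ((exp_pos 2).trans_le (hx3.trans h₃))).mpr (hx3.trans h₃)
  have hexp : exp 1 ≤ exp 2 := exp_le_exp.mpr one_le_two
  rw [h₄]
  exact div_log_monotoneOn (hexp.trans hx3) (hexp.trans (hx3.trans h₃)) h₃

end TruncatedLog

theorem theorem3 (A ε : ℝ) (hA : 0 < A) (hε : 0 < ε) :
    ∃ q₀ T₀ : ℝ, ∀ (F : Type*) [Field F] [Finite F] (q : ℕ) (T : ℝ),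
      Nat.card F = q → q₀ ≤ (q : ℝ) → T₀ ≤ T →
      (truncLog ((q : ℝ) - 1)) ^ ((1 + ε) * A * iterTruncLog 3 q / iterTruncLog 4 q) ≤ T →
      ∑ t ∈ Finset.Icc 1 ⌊T⌋₊, (numIrreducibleBinomials F t : ℝ) ≤
        ((q : ℝ) - 1) * T / (truncLog T) ^ A := by
  obtain ⟨x₀, hx₀⟩ := eventually_atTop.mp <|
    (tendsto_log_atTop.eventually (eventually_card_factoredNumbersUpTo_le hA hε)).and <|
      eventually_div_log_le_iterTruncLog.and (tendsto_log_atTop.eventually_ge_atTop 2)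
  refine ⟨x₀ + 1, exp 2, ?_⟩
  rintro F _ _ q T rfl hq hT₀ hT
  obtain ⟨hcount, hquot, hlog⟩ := hx₀ (Nat.card F - 1) (by linarith)
  have hcard : 1 < Nat.card F := Finite.one_lt_card
  have hcast : ((Nat.card F - 1 : ℕ) : ℝ) = Nat.card F - 1 := Nat.cast_pred (by lia)
  rw [sub_add_cancel] at hquot
  rw [truncLog_eq_log hlog, mul_div_assoc] at hT
  have hprimes := sum_log_primeFactors_le_log (Nat.card F - 1)
  rw [hcast] at hprimes
  rw [truncLog_eq_log ((le_log_iff_exp_le ((exp_pos 2).trans_le hT₀)).mpr hT₀), mul_div_assoc]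
  refine (sum_numIrreducibleBinomials_le ⌊T⌋₊).trans ?_
  rw [← hcast]
  gcongr
  refine hcount _ (fun p => Nat.prime_of_mem_primeFactors) hprimes T (le_trans ?_ hT)
  exact rpow_le_rpow_of_exponent_le (by linarith) (by gcongr)
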